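/- Let $A$ and $B$ be finite sets and let $W\subseteq (A\times B)^\omega$. In each round $i\in\mathbb N$, Players 1 and 2 concurrently choose actions $a_i\in A$ and $b_i\in B$, and Player 1 wins the play $(a_0,b_0)(a_1,b_1)\cdots$ iff it belongs to $W$. A strategy (of Player 1) is a map $s:(A\times B)^*\to A$; it is winning from a history $h\in(A\times B)^*$ if, for every $\beta\in B^\omega$, the play in which first $h$ is played, and then Player 1 follows $s$ while Player 2 plays the letters of $\beta$ in order, belongs to $W$. A history is winning if some strategy is winning from it. An action $a\in A$ is non-losing for a history $h$ if $h(a,b)$ is a winning history for every $b\in B$. Let $\Gamma$ be the set of histories along which Player 1 has played only non-losing actions, i.e. the set of all $h$ such that $a$ is non-losing for $p$ whenever $p(a,b)$ is a prefix of $h$. For a history $h$ let $W_h=\{\rho\in(A\times B)^\omega \mid h\rho\in W\}$. A strategy $s$ is finite-memory if there are a finite set $M$, an element $m_0\in M$ and maps $\sigma:M\to A$ and $\mu:M\times(A\times B)\to M$ such that $s(h)=\sigma(\mu(m_0,h))$ for all histories $h$, where $\mu$ is extended to histories by $\mu(m,\varepsilon)=m$ and $\mu(m,h(a,b))=\mu(\mu(m,h),(a,b))$.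 **Theorem.** Assume that $W$ is in $\Delta^0_2$ for the cylinder topology on $(A\times B)^\omega$ (i.e. $W$ is both a countable union of closed sets and a countable intersection of open sets), and that inclusion is a well partial order on $\{W_h\mid h\in\Gamma\}$ (i.e. for every sequence $(h_n)_{n\in\mathbb N}$ in $\Gamma$ there are $k<l$ with $W_{h_k}\subseteq W_{h_l}$). If Player 1 has a winning strategy from the empty history $\varepsilon$, then she has a finite-memory strategy that is winning from $\varepsilon$. -/

import Mathlib

namespace ConcurrentGame

/-- A concurrent game `(A, B, W)`: in each round the two players simultaneously choose an action
in `A` and `B`; Player 1 wins a play, an infinite word over `A × B`, iff it lies in `W`. -/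
abbrev Play (A B : Type*) := ℕ → A × B

/-- Histories are the finite words over `A × B`, the earliest round first. -/
abbrev History (A B : Type*) := List (A × B)

/-- A strategy of Player 1. -/
abbrev Strategy (A B : Type*) := History A B → A

/-- The infinite word `w ρ`: the finite word `w` followed by the infinite word `ρ`. -/
def prepend {C : Type*} (w : List C) (ρ : ℕ → C) : ℕ → C :=
  fun n => if hn : n < w.length then w[n] else ρ (n - w.length)

/-- The history reached from `h` after `n` more rounds, in which Player 1 follows `s` and
Player 2 plays `β 0, …, β (n - 1)`. -/
def outHistory {A B : Type*} (h : History A B) (s : Strategy A B) (β : ℕ → B) :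
    ℕ → History A B
  | 0 => h
  | n + 1 => outHistory h s β n ++ [(s (outHistory h s β n), β n)]

/-- The play `out(h, s, β)`: first `h` is played, then Player 1 follows `s` and Player 2 plays the
letters of `β` in order. -/
def out {A B : Type*} (h : History A B) (s : Strategy A B) (β : ℕ → B) : Play A B :=
  prepend h (fun n => (s (outHistory h s β n), β n))

/-- The strategy `s` of Player 1 is winning from the history `h`. -/
def IsWinningFrom {A B : Type*} (W : Set (Play A B)) (h : History A B) (s : Strategy A B) : Prop :=
  ∀ β : ℕ → B, out h s β ∈ W

/-- `h` is a winning history: Player 1 has a winning strategy from `h`. -/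
def IsWinningHistory {A B : Type*} (W : Set (Play A B)) (h : History A B) : Prop :=
  ∃ s : Strategy A B, IsWinningFrom W h s

/-- The action `a` of Player 1 is non-losing for `h`: whatever Player 2 answers, the next history
is winning. -/
def IsNonLosing {A B : Type*} (W : Set (Play A B)) (h : History A B) (a : A) : Prop :=
  ∀ b : B, IsWinningHistory W (h ++ [(a, b)])

/-- The set `Γ` of the histories along which Player 1 has played only non-losing actions. -/
def Gamma {A B : Type*} (W : Set (Play A B)) : Set (History A B) :=
  {h | ∀ (p : History A B) (a : A) (b : B), p ++ [(a, b)] <+: h → IsNonLosing W p a}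

/-- The winning set `W_h = {ρ | h ρ ∈ W}` induced by the history `h`. -/
def inducedWinningSet {A B : Type*} (W : Set (Play A B)) (h : History A B) : Set (Play A B) :=
  {ρ | prepend h ρ ∈ W}

/-- A finite-memory decision machine `(M, σ, μ, m₀)`. -/
structure FiniteMemoryMachine (A B : Type*) where
  /-- the memory -/
  M : Type
  finite_memory : Finite M
  /-- the decision function -/
  σ : M → A
  /-- the memory update function -/
  μ : M → A × B → M
  /-- the initial memory state -/
  m₀ : M

/-- The strategy `h ↦ σ (μ (m₀, h))`, where `μ` is extended to histories letter by letter. -/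
def FiniteMemoryMachine.strategy {A B : Type*} (D : FiniteMemoryMachine A B) : Strategy A B :=
  fun h => D.σ (h.foldl D.μ D.m₀)

/-- A strategy is finite-memory if it is induced by some finite-memory decision machine. -/
def IsFiniteMemory {A B : Type*} (s : Strategy A B) : Prop :=
  ∃ D : FiniteMemoryMachine A B, s = D.strategy

/-- The class `Δ⁰₂`: countable unions of closed sets that are also countable intersections of
open sets. -/
def IsDelta02 {X : Type*} [TopologicalSpace X] (S : Set X) : Prop :=
  (∃ F : ℕ → Set X, (∀ n, IsClosed (F n)) ∧ S = ⋃ n, F n) ∧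
    (∃ U : ℕ → Set X, (∀ n, IsOpen (U n)) ∧ S = ⋂ n, U n)

end ConcurrentGame

open ConcurrentGame

/-! By well partial order, finitely many minimal sets `W_{v r}` lie below all `W_h` with `h ∈ Γ`.
Player 1 pretends that the history is `v r`, follows for a block of `n` rounds a strategy `S r`
winning from `v r`, then replaces the pretended history by a representative with a smaller winning
set. The pretended winning set `X` thus always stays inside the true one; let `Z` be the complement
of the true one.

Each block satisfies its own local goal, yet the infinite concatenation could still lose. This is
excluded by a rank. As `W` is `Δ⁰₂`, `X` and `Z` are disjoint `Gδ` sets, so by Baire's theorem the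
derivative `D ↦ cl(cl(D ∩ Z) ∩ X)` has no nonempty closed set contained in its own image, and every
point has an ordinal rank. Along a play the rank cannot increase, so it stabilises at some `γ`, and
then `cl(D_γ ∩ Z)` misses `X` (`exists_eventually_const_rank`). A losing play would continue inside
that closed set, whereas all plays following `S r` lie in `X`; by compactness the play must deviate
from `S r` within a bounded time. The well partial order makes this bound uniform
(`exists_forall_lt_ne`), and choosing `n` above it gives a contradiction. -/

namespace ConcurrentGame

open Set Topology

universe u

/-! ### Transfinite derivatives separating two disjoint `Gδ` sets -/

section AlternatingDerivative

variable {T T' : Type u} [TopologicalSpace T] [TopologicalSpace T']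

/-- The points of `S` that are limits of points of `X` which are limits of points of `S ∩ Z`. -/
def altClosure (X Z S : Set T) : Set T := closure (closure (S ∩ Z) ∩ X)

/-- The transfinite iteration of `altClosure X Z`, starting from the whole space. -/
def altDerivative (X Z : Set T) (γ : Ordinal.{u}) : Set T :=
  ⋂ δ : Iio γ, altClosure X Z (altDerivative X Z δ.1)
termination_by γ
decreasing_by exact δ.2

theorem mem_altDerivative {X Z : Set T} {γ : Ordinal.{u}} {x : T} :
    x ∈ altDerivative X Z γ ↔ ∀ δ < γ, x ∈ altClosure X Z (altDerivative X Z δ) := by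
  rw [altDerivative]
  simp

theorem isClosed_altDerivative (X Z : Set T) (γ : Ordinal.{u}) :
    IsClosed (altDerivative X Z γ) := by
  rw [altDerivative]
  exact isClosed_iInter fun _ => isClosed_closure

theorem altDerivative_antitone (X Z : Set T) : Antitone (altDerivative X Z) :=
  fun _ _ h _ hx => mem_altDerivative.2 fun δ hδ => mem_altDerivative.1 hx δ (hδ.trans_le h)

theorem mapsTo_altClosure {X Z S : Set T} {X' Z' S' : Set T'} {f : T' → T} (hf : Continuous f)
    (hX : MapsTo f X' X) (hZ : MapsTo f Z' Z) (hS : MapsTo f S' S) :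
    MapsTo f (altClosure X' Z' S') (altClosure X Z S) :=
  (((hS.inter_inter hZ).closure hf).inter_inter hX).closure hf

/-- Used with `f` a prepending map, to compare successive blocks, and with `f = id`, as monotonicity
in `Z`. -/
theorem mapsTo_altDerivative {X Z : Set T} {X' Z' : Set T'} {f : T' → T} (hf : Continuous f)
    (hX : MapsTo f X' X) (hZ : MapsTo f Z' Z) (γ : Ordinal.{u}) :
    MapsTo f (altDerivative X' Z' γ) (altDerivative X Z γ) := by
  induction γ using WellFoundedLT.induction with
  | ind γ ih =>
    intro x hx
    rw [mem_altDerivative] at hx ⊢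
    exact fun δ hδ => mapsTo_altClosure hf hX hZ (ih δ hδ) (hx δ hδ)

/-- Both `X` and `Z` would be dense `Gδ` sets in the compact space `D`, so by Baire they would meet
if `D` were nonempty. -/
theorem eq_empty_of_subset_altClosure [CompactSpace T] [T2Space T] {X Z D : Set T}
    (hX : IsGδ X) (hZ : IsGδ Z) (hXZ : Disjoint X Z) (hD : IsClosed D)
    (h : D ⊆ altClosure X Z D) : D = ∅ := by
  have hDZ : closure (D ∩ Z) ⊆ D := closure_minimal inter_subset_left hD
  have h₁ : D ⊆ closure (D ∩ Z) :=
    h.trans (closure_minimal inter_subset_left isClosed_closure)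
  have h₂ : D ⊆ closure (D ∩ X) := h.trans (closure_mono (inter_subset_inter_left X hDZ))
  have : CompactSpace D := isCompact_iff_compactSpace.1 hD.isCompact
  have dense_of {Y : Set T} (hY : D ⊆ closure (D ∩ Y)) : Dense ((↑) ⁻¹' Y : Set D) := by
    rw [Subtype.dense_iff, Subtype.image_preimage_coe]
    exact hY
  have hdense := Dense.inter_of_Gδ (hX.preimage continuous_subtype_val)
    (hZ.preimage continuous_subtype_val) (dense_of h₂) (dense_of h₁)
  rw [← preimage_inter, hXZ.inter_eq, preimage_empty] at hdense
  by_contra hne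
  obtain ⟨x, hx⟩ := nonempty_iff_ne_empty.2 hne
  have : Nonempty D := ⟨⟨x, hx⟩⟩
  exact hdense.nonempty.ne_empty rfl

/-- The ordinals do not inject into `Set T`, so two stages coincide; that stage is contained in its
own derivative, hence empty. A point without rank would belong to it. -/
theorem exists_notMem_altClosure [CompactSpace T] [T2Space T] {X Z : Set T}
    (hX : IsGδ X) (hZ : IsGδ Z) (hXZ : Disjoint X Z) (x : T) :
    ∃ γ, x ∉ altClosure X Z (altDerivative X Z γ) := by
  by_contra! hx
  have hinj := not_injective_of_ordinal (altDerivative X Z)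
  simp only [Function.Injective, not_forall] at hinj
  obtain ⟨a, b, hab, hne⟩ := hinj
  wlog hlt : a < b generalizing a b
  · exact this b a hab.symm (Ne.symm hne) (lt_of_le_of_ne (not_lt.1 hlt) (Ne.symm hne))
  have hempty := eq_empty_of_subset_altClosure hX hZ hXZ (isClosed_altDerivative X Z a)
    fun y hy => mem_altDerivative.1 (hab ▸ hy) a hlt
  have : x ∈ altDerivative X Z a := mem_altDerivative.2 fun δ _ => hx δ
  simp [hempty] at this

end AlternatingDerivative

/-! ### Prepending words, and stabilisation of the rank -/

section Prepend

variable {C : Type u}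

theorem prepend_apply_of_lt {w : List C} {n : ℕ} (h : n < w.length) (ρ : ℕ → C) :
    prepend w ρ n = w[n] := dif_pos h

theorem prepend_apply_add (w : List C) (ρ : ℕ → C) (n : ℕ) :
    prepend w ρ (w.length + n) = ρ n := by
  simp [prepend]

@[simp]
theorem prepend_nil (ρ : ℕ → C) : prepend [] ρ = ρ := by
  funext n
  simp [prepend]

theorem prepend_append (w w' : List C) (ρ : ℕ → C) :
    prepend (w ++ w') ρ = prepend w (prepend w' ρ) := by
  funext n
  by_cases h₁ : n < w.length
  · rw [prepend_apply_of_lt h₁, prepend_apply_of_lt (by simp; omega),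
      List.getElem_append_left h₁]
  · obtain ⟨m, rfl⟩ := Nat.exists_eq_add_of_le (not_lt.1 h₁)
    rw [prepend_apply_add]
    by_cases h₂ : m < w'.length
    · rw [prepend_apply_of_lt h₂, prepend_apply_of_lt (by simp; omega),
        List.getElem_append_right (by omega)]
      simp
    · obtain ⟨l, rfl⟩ := Nat.exists_eq_add_of_le (not_lt.1 h₂)
      rw [prepend_apply_add, ← Nat.add_assoc, ← List.length_append, prepend_apply_add]

theorem prepend_injective (w : List C) : Function.Injective (prepend w) := by
  intro ρ ρ' h
  funext n
  rw [← prepend_apply_add w ρ, h, prepend_apply_add]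

theorem continuous_prepend [TopologicalSpace C] (w : List C) :
    Continuous (prepend w : (ℕ → C) → ℕ → C) := by
  refine continuous_pi fun n => ?_
  unfold prepend
  split_ifs
  · exact continuous_const
  · exact continuous_apply _

theorem exists_cylinder_disjoint [TopologicalSpace C] [DiscreteTopology C] {F : Set (ℕ → C)}
    (hF : IsClosed F) {ρ : ℕ → C} (hρ : ρ ∉ F) :
    ∃ N, ∀ ρ', (∀ n < N, ρ' n = ρ n) → ρ' ∉ F := by
  obtain ⟨I, t, ht, hsub⟩ := isOpen_pi_iff.1 hF.isOpen_compl ρ hρ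
  refine ⟨I.sup id + 1, fun ρ' h => hsub fun n hn => ?_⟩
  rw [h n (Nat.lt_succ_of_le (Finset.le_sup (f := id) hn))]
  exact (ht n hn).2

/-- If the data of consecutive indices are related by prepending a nonempty word, then the rank
of the point in the alternating derivatives eventually becomes constant. -/
theorem exists_eventually_const_rank [TopologicalSpace C] [DiscreteTopology C] [Finite C]
    {X Z : ℕ → Set (ℕ → C)} (hX : ∀ i, IsGδ (X i)) (hZ : ∀ i, IsGδ (Z i))
    (hXZ : ∀ i, Disjoint (X i) (Z i)) {ρ : ℕ → ℕ → C}
    (hstep : ∀ i, ∃ w : List C, w ≠ [] ∧ prepend w (ρ (i + 1)) = ρ i ∧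
      MapsTo (prepend w) (X (i + 1)) (X i) ∧ MapsTo (prepend w) (Z (i + 1)) (Z i)) :
    ∃ i γ, ρ i ∈ altDerivative (X i) (Z i) γ ∧
      altClosure (X i) (Z i) (altDerivative (X i) (Z i) γ) = ∅ := by
  have hsteps (i m : ℕ) : ∃ w : List C, m ≤ w.length ∧ prepend w (ρ (i + m)) = ρ i ∧
      MapsTo (prepend w) (X (i + m)) (X i) ∧ MapsTo (prepend w) (Z (i + m)) (Z i) := by
    induction m with
    | zero => exact ⟨[], by simp, by simp, fun x hx => by simpa using hx,
        fun x hx => by simpa using hx⟩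
    | succ m ih =>
      obtain ⟨w, hw, hρ, hwX, hwZ⟩ := ih
      obtain ⟨w', hw', hρ', hwX', hwZ'⟩ := hstep (i + m)
      have hcomp : (prepend (w ++ w') : (ℕ → C) → ℕ → C) = prepend w ∘ prepend w' :=
        funext (prepend_append w w')
      refine ⟨w ++ w', ?_, ?_, ?_, ?_⟩
      · have := List.length_pos_iff.2 hw'
        simp only [List.length_append]
        omega
      · rw [prepend_append, ← Nat.add_assoc, hρ', hρ]
      · rw [hcomp]
        exact hwX.comp hwX'
      · rw [hcomp]
        exact hwZ.comp hwZ'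
  let P : Set Ordinal.{u} :=
    {γ | ∃ i, ρ i ∉ altClosure (X i) (Z i) (altDerivative (X i) (Z i) γ)}
  have hP : P.Nonempty :=
    (exists_notMem_altClosure (hX 0) (hZ 0) (hXZ 0) (ρ 0)).imp fun γ hγ => ⟨0, hγ⟩
  -- `γ` is the least rank attained along the sequence. A whole cylinder around `ρ i` avoids the
  -- derivative of stage `γ`; after `N` more steps the prepended word fills that cylinder, so no
  -- continuation at all is left in the derivative.
  obtain ⟨γ, ⟨i, hi⟩, hmin⟩ := WellFounded.has_min (wellFounded_lt (α := Ordinal.{u})) P hP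
  obtain ⟨N, hN⟩ := exists_cylinder_disjoint isClosed_closure hi
  refine ⟨i + N, γ, mem_altDerivative.2 fun δ hδ => ?_, ?_⟩
  · by_contra hnot
    exact hmin δ ⟨_, hnot⟩ hδ
  · obtain ⟨w, hw, hρ, hwX, hwZ⟩ := hsteps i N
    refine eq_empty_iff_forall_notMem.2 fun x hx => hN (prepend w x) (fun n hn => ?_) <|
      mapsTo_altClosure (continuous_prepend w) hwX hwZ
        (mapsTo_altDerivative (continuous_prepend w) hwX hwZ γ) hx
    rw [← hρ, prepend_apply_of_lt (hn.trans_le hw), prepend_apply_of_lt (hn.trans_le hw)]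

end Prepend

/-! ### Comparing histories by their winning sets -/

section Histories

variable {A B : Type*} {W : Set (Play A B)}

theorem prepend_outHistory (h : History A B) (s : Strategy A B) (β : ℕ → B) (m : ℕ) :
    prepend (outHistory h s β m) (fun n => (s (outHistory h s β (m + n)), β (m + n))) =
      out h s β := by
  induction m with
  | zero => simp [outHistory, out]
  | succ m ih =>
    rw [← ih, outHistory, prepend_append]
    congr 1
    funext n
    cases n with
    | zero => simp [prepend]
    | succ n => simp [prepend, Nat.add_comm, Nat.add_left_comm]

theorem outHistory_add (h : History A B) (s : Strategy A B) (β : ℕ → B) (m n : ℕ) :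
    outHistory h s β (m + n) = outHistory (outHistory h s β m) s (fun i => β (m + i)) n := by
  induction n with
  | zero => rfl
  | succ n ih => rw [← Nat.add_assoc, outHistory, ih, outHistory]

theorem IsWinningFrom.append {h : History A B} {s : Strategy A B} (hs : IsWinningFrom W h s)
    (b : B) : IsWinningFrom W (h ++ [(s h, b)]) s := by
  intro β
  let β' : ℕ → B := fun n => if n = 0 then b else β (n - 1)
  have hout : outHistory h s β' 1 = h ++ [(s h, b)] := by simp [outHistory, β']
  have hβ : (fun i => β' (1 + i)) = β := by
    funext i
    simp [β']
  have hmem := hs β'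
  rw [← prepend_outHistory h s β' 1] at hmem
  simp only [outHistory_add h s β' 1, hout, congrFun hβ] at hmem
  exact hmem

theorem inducedWinningSet_append (h w : History A B) :
    inducedWinningSet W (h ++ w) = prepend w ⁻¹' inducedWinningSet W h := by
  ext ρ
  simp [inducedWinningSet, prepend_append]

theorem inducedWinningSet_append_mono {r g : History A B}
    (h : inducedWinningSet W r ⊆ inducedWinningSet W g) (w : History A B) :
    inducedWinningSet W (r ++ w) ⊆ inducedWinningSet W (g ++ w) := by
  rw [inducedWinningSet_append, inducedWinningSet_append]
  exact preimage_mono h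

/-- After `g ++ k`, play what the strategy winning from `r` plays after `r ++ k`. -/
theorem IsWinningHistory.mono {r g : History A B}
    (h : inducedWinningSet W r ⊆ inducedWinningSet W g) (hr : IsWinningHistory W r) :
    IsWinningHistory W g := by
  obtain ⟨s, hs⟩ := hr
  let s' : Strategy A B := fun k => s (r ++ k.drop g.length)
  refine ⟨s', fun β => ?_⟩
  have key (n : ℕ) : ∃ k, outHistory r s β n = r ++ k ∧ outHistory g s' β n = g ++ k := by
    induction n with
    | zero => exact ⟨[], by simp [outHistory]⟩
    | succ n ih =>
      obtain ⟨k, h₁, h₂⟩ := ih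
      exact ⟨k ++ [(s (r ++ k), β n)], by simp [outHistory, h₁], by simp [outHistory, h₂, s']⟩
  have hplay : (fun n => (s' (outHistory g s' β n), β n)) =
      fun n => (s (outHistory r s β n), β n) := by
    funext n
    obtain ⟨k, h₁, h₂⟩ := key n
    simp [h₁, h₂, s']
  have := h (hs β)
  rwa [← hplay] at this

theorem IsNonLosing.mono {r g : History A B} {a : A}
    (h : inducedWinningSet W r ⊆ inducedWinningSet W g) (hr : IsNonLosing W r a) :
    IsNonLosing W g a :=
  fun b => (hr b).mono (inducedWinningSet_append_mono h _)

theorem nil_mem_Gamma : [] ∈ Gamma W := by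
  intro p a b h
  simp at h

theorem append_mem_Gamma {h : History A B} (hh : h ∈ Gamma W) {a : A} (ha : IsNonLosing W h a)
    (b : B) : h ++ [(a, b)] ∈ Gamma W := by
  intro p a' b' hp
  rcases List.prefix_concat_iff.1 hp with heq | hp
  · obtain ⟨rfl, heq⟩ := List.append_inj' heq rfl
    obtain ⟨rfl, rfl⟩ : a' = a ∧ b' = b := by simpa using heq
    exact ha
  · exact hh p a' b' hp

theorem isWinningHistory_of_mem_Gamma (hwin : IsWinningHistory W []) {h : History A B}
    (hh : h ∈ Gamma W) : IsWinningHistory W h := by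
  rcases List.eq_nil_or_concat h with rfl | ⟨p, ⟨a, b⟩, rfl⟩
  · exact hwin
  · rw [List.concat_eq_append] at hh ⊢
    exact hh p a b List.prefix_rfl b

/-- Following from `g` a strategy that wins from a history `r` with a smaller winning set. -/
theorem mem_Gamma_of_outHistory {r g : History A B} (hr : r ∈ Gamma W) (hg : g ∈ Gamma W)
    (hrg : inducedWinningSet W r ⊆ inducedWinningSet W g) {s : Strategy A B}
    (hs : IsWinningFrom W r s) (β : ℕ → B) (n : ℕ) :
    ∃ w, outHistory r s β n = r ++ w ∧ r ++ w ∈ Gamma W ∧ g ++ w ∈ Gamma W ∧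
      IsWinningFrom W (r ++ w) s := by
  induction n with
  | zero => exact ⟨[], by simpa [outHistory] using ⟨hr, hg, hs⟩⟩
  | succ n ih =>
    obtain ⟨w, hw, hrw, hgw, hsw⟩ := ih
    have hnl : IsNonLosing W (r ++ w) (s (r ++ w)) := fun b => ⟨s, hsw.append b⟩
    refine ⟨w ++ [(s (r ++ w), β n)], by simp [outHistory, hw], ?_, ?_, ?_⟩
    · simpa using append_mem_Gamma hrw hnl (β n)
    · simpa using append_mem_Gamma hgw (hnl.mono (inducedWinningSet_append_mono hrg w)) (β n)
    · simpa using hsw.append (β n)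

/-- The minimal elements form an antichain, which is finite in a well partial order. -/
theorem exists_finite_basis {X : Type*} {S : Set (Set X)} (hS : S.IsPWO) :
    ∃ R ⊆ S, R.Finite ∧ ∀ x ∈ S, ∃ r ∈ R, r ⊆ x := by
  refine ⟨{x | Minimal (· ∈ S) x}, fun x hx => hx.1, ?_, fun x hx => ?_⟩
  · exact (setOfPred_minimal_antichain (· ∈ S)).finite_of_partiallyWellOrderedOn
      (hS.mono fun x hx => hx.1)
  · obtain ⟨r, hrx, hr⟩ := hS.exists_le_minimal hx
    exact ⟨r, hr, hrx⟩

end Histories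

/-! ### A uniform bound on following a winning strategy -/

section FollowBound

variable {A B : Type*} [TopologicalSpace A] [DiscreteTopology A] [TopologicalSpace B]
  [DiscreteTopology B] {W : Set (Play A B)}

/-- The condition depends on finitely many letters only. -/
theorem isClosed_setOf_follows (r : History A B) (s : Strategy A B) (n : ℕ) :
    IsClosed {ρ : Play A B | (ρ n).1 = s (outHistory r s (fun i => (ρ i).2) n)} := by
  have happ (i : ℕ) : IsLocallyConstant fun ρ : Play A B => ρ i :=
    (IsLocallyConstant.iff_continuous _).2 (continuous_apply i)
  have hout (i : ℕ) :
      IsLocallyConstant fun ρ : Play A B => outHistory r s (fun j => (ρ j).2) i := by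
    induction i with
    | zero => exact IsLocallyConstant.const r
    | succ i ih => exact ih.comp₂ (happ i) fun h c => h ++ [(s h, c.2)]
  simpa using ((happ n).comp₂ (hout n) fun c h => c.1 = s h).isClosed_fiber True

/-- For one pair `(g, γ)` this is compactness: a play following `s` forever would lie in `W_r`,
which the closed set misses. Uniformity holds because that closed set shrinks as `W_g` and `γ` grow,
and such pairs are well partially ordered. -/
theorem exists_forall_lt_ne [Finite A] [Finite B]
    (hwpo : (inducedWinningSet W '' Gamma W).IsPWO)
    {r : History A B} {s : Strategy A B} (hs : IsWinningFrom W r s) :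
    ∃ n, ∀ g ∈ Gamma W, ∀ γ,
      altClosure (inducedWinningSet W r) (inducedWinningSet W g)ᶜ
        (altDerivative (inducedWinningSet W r) (inducedWinningSet W g)ᶜ γ) = ∅ →
      ∀ ρ ∈ closure (altDerivative (inducedWinningSet W r) (inducedWinningSet W g)ᶜ γ ∩
          (inducedWinningSet W g)ᶜ),
        ∃ i < n, (ρ i).1 ≠ s (outHistory r s (fun j => (ρ j).2) i) := by
  by_contra! hcon
  choose g hg γ hγ ρ hρ hfol using hcon
  have hγpwo : (univ : Set Ordinal).IsPWO := Set.isPWO_of_wellQuasiOrderedLE univ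
  -- Along a monotone subsequence of counterexamples, all the plays lie in the closed set `E` of its
  -- first pair.
  obtain ⟨φ, hφ⟩ := (PartiallyWellOrderedOn.prod hwpo hγpwo).exists_monotone_subseq
    (f := fun n => (inducedWinningSet W (g n), γ n))
    fun n => mk_mem_prod (mem_image_of_mem _ (hg n)) (mem_univ _)
  let X := inducedWinningSet W r
  let Z := (inducedWinningSet W (g (φ 0)))ᶜ
  let E := closure (altDerivative X Z (γ (φ 0)) ∩ Z)
  have hE (k : ℕ) : ρ (φ k) ∈ E := by
    obtain ⟨h₁, h₂⟩ := hφ 0 k k.zero_le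
    have hZ : MapsTo id (inducedWinningSet W (g (φ k)))ᶜ Z := fun _ hx hx' => hx (h₁ hx')
    have hD : MapsTo id (altDerivative X (inducedWinningSet W (g (φ k)))ᶜ (γ (φ k)))
        (altDerivative X Z (γ (φ 0))) := fun _ hx =>
      altDerivative_antitone X Z h₂ (mapsTo_altDerivative continuous_id (mapsTo_id X) hZ _ hx)
    exact (hD.inter_inter hZ).closure continuous_id (hρ (φ k))
  let K (n : ℕ) : Set (Play A B) :=
    E ∩ ⋂ i < n, {ρ | (ρ i).1 = s (outHistory r s (fun j => (ρ j).2) i)}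
  have hK (n : ℕ) : IsClosed (K n) :=
    isClosed_closure.inter (isClosed_biInter fun i _ => isClosed_setOf_follows r s i)
  obtain ⟨x, hx⟩ := IsCompact.nonempty_iInter_of_sequence_nonempty_isCompact_isClosed K
    (fun n => inter_subset_inter_right E
      (biInter_subset_biInter_left fun i (hi : i < n) => hi.trans n.lt_succ_self))
    (fun n => ⟨ρ (φ n), hE n, mem_iInter₂.2 fun i hi =>
      hfol (φ n) i (hi.trans_le (φ.strictMono.le_apply))⟩)
    (hK 0).isCompact hK
  rw [mem_iInter] at hx
  have hplay : x = fun n => (s (outHistory r s (fun j => (x j).2) n), (x n).2) := by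
    funext n
    exact Prod.ext (mem_iInter₂.1 (hx (n + 1)).2 n n.lt_succ_self) rfl
  have hxX : x ∈ X := by
    rw [hplay]
    exact hs fun j => (x j).2
  have : x ∈ altClosure X Z (altDerivative X Z (γ (φ 0))) := subset_closure ⟨(hx 0).1, hxX⟩
  rw [hγ] at this
  exact this

end FollowBound

/-! ### The finite-memory block strategy -/

section BlockStrategy

variable {A B : Type*} {W : Set (Play A B)} {R : Type*}

/-- A machine needs its memory in `Type`, so `M` from any universe is transported to some `Fin n`.
-/
theorem isFiniteMemory_foldl {M : Type*} [Finite M] (σ : M → A) (μ : M → A × B → M) (m₀ : M) :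
    IsFiniteMemory fun h : History A B => σ (h.foldl μ m₀) := by
  obtain ⟨n, ⟨e⟩⟩ := Finite.exists_equiv_fin M
  refine ⟨⟨Fin n, inferInstance, fun i => σ (e.symm i), fun i c => e (μ (e.symm i) c), e m₀⟩, ?_⟩
  have key (h : History A B) (m : M) :
      h.foldl (fun i c => e (μ (e.symm i) c)) (e m) = e (h.foldl μ m) := by
    induction h generalizing m with
    | nil => rfl
    | cons c h ih => simp [ih]
  funext h
  simp [FiniteMemoryMachine.strategy, key]

/-- The memory consists of an index and a word of length less than `n`, representing the history
`v r ++ k`. As soon as the word would have length `n`, the history represented is replaced by the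
one that `rep` chooses for it. -/
def blockUpdate (v : R → History A B) (rep : History A B → R) (n : ℕ)
    (m : R × {l : List (A × B) // l.length < n}) (c : A × B) :
    R × {l : List (A × B) // l.length < n} :=
  if h : (m.2.1 ++ [c]).length < n then (m.1, ⟨m.2.1 ++ [c], h⟩)
  else (rep (v m.1 ++ (m.2.1 ++ [c])), ⟨[], (Nat.zero_le _).trans_lt m.2.2⟩)

/-- In the memory state `(r, k)`, act as the strategy `S r` does after the history `v r ++ k`. -/
def blockStrategy (v : R → History A B) (S : R → Strategy A B) (rep : History A B → R) {n : ℕ}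
    (hn : 0 < n) : Strategy A B := fun h =>
  let m := h.foldl (blockUpdate v rep n) (rep [], ⟨[], hn⟩)
  S m.1 (v m.1 ++ m.2.1)

variable (v : R → History A B) (S : R → Strategy A B) (rep : History A B → R) {n : ℕ} (hn : 0 < n)

theorem isFiniteMemory_blockStrategy [Finite A] [Finite B] [Finite R] :
    IsFiniteMemory (blockStrategy v S rep hn) := by
  have : Finite {l : List (A × B) // l.length < n} := List.finite_length_lt (A × B) n
  exact isFiniteMemory_foldl (fun m : R × {l : List (A × B) // l.length < n} =>
    S m.1 (v m.1 ++ m.2.1)) (blockUpdate v rep n) (rep [], ⟨[], hn⟩)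

theorem outHistory_blockStrategy {g : History A B} {r : R}
    (hg : g.foldl (blockUpdate v rep n) (rep [], ⟨[], hn⟩) = (r, ⟨[], hn⟩)) (β : ℕ → B)
    (j : ℕ) (hj : j < n) :
    ∃ (k : List (A × B)) (hk : k.length < n), k.length = j ∧
      outHistory g (blockStrategy v S rep hn) β j = g ++ k ∧
      outHistory (v r) (S r) β j = v r ++ k ∧
      (g ++ k).foldl (blockUpdate v rep n) (rep [], ⟨[], hn⟩) = (r, ⟨k, hk⟩) := by
  induction j with
  | zero => exact ⟨[], hn, rfl, by simp [outHistory], by simp [outHistory], by simpa using hg⟩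
  | succ j ih =>
    obtain ⟨k, hk, hlen, h₁, h₂, h₃⟩ := ih (by omega)
    have hk' : (k ++ [(S r (v r ++ k), β j)]).length < n := by simpa [hlen] using hj
    refine ⟨k ++ [(S r (v r ++ k), β j)], hk', by simp [hlen], ?_, by simp [outHistory, h₂], ?_⟩
    · rw [outHistory, h₁, blockStrategy, h₃, List.append_assoc]
    · rw [← List.append_assoc, List.foldl_append, h₃, List.foldl_cons, List.foldl_nil,
        blockUpdate, dif_pos hk']

theorem outHistory_blockStrategy_block {g : History A B} {r : R}
    (hg : g.foldl (blockUpdate v rep n) (rep [], ⟨[], hn⟩) = (r, ⟨[], hn⟩)) (β : ℕ → B) :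
    ∃ k : List (A × B), k ≠ [] ∧
      outHistory g (blockStrategy v S rep hn) β n = g ++ k ∧
      outHistory (v r) (S r) β n = v r ++ k ∧
      (g ++ k).foldl (blockUpdate v rep n) (rep [], ⟨[], hn⟩) = (rep (v r ++ k), ⟨[], hn⟩) := by
  obtain ⟨j, rfl⟩ := Nat.exists_eq_succ_of_ne_zero hn.ne'
  obtain ⟨k, hk, hlen, h₁, h₂, h₃⟩ :=
    outHistory_blockStrategy v S rep hn hg β j j.lt_succ_self
  have hk' : ¬(k ++ [(S r (v r ++ k), β j)]).length < j + 1 := by simp [hlen]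
  refine ⟨k ++ [(S r (v r ++ k), β j)], by simp, ?_, by simp [outHistory, h₂], ?_⟩
  · rw [outHistory, h₁, blockStrategy, h₃, List.append_assoc]
  · rw [← List.append_assoc, List.foldl_append, h₃, List.foldl_cons, List.foldl_nil,
      blockUpdate, dif_neg hk']

theorem isWinningFrom_blockStrategy [Finite A] [Finite B]
    [TopologicalSpace A] [DiscreteTopology A] [TopologicalSpace B] [DiscreteTopology B]
    (hW : IsDelta02 W) (hv : ∀ r, v r ∈ Gamma W)
    (hrep : ∀ h ∈ Gamma W, inducedWinningSet W (v (rep h)) ⊆ inducedWinningSet W h)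
    (hS : ∀ r, IsWinningFrom W (v r) (S r))
    (hbound : ∀ r, ∀ g ∈ Gamma W, ∀ γ,
      altClosure (inducedWinningSet W (v r)) (inducedWinningSet W g)ᶜ
        (altDerivative (inducedWinningSet W (v r)) (inducedWinningSet W g)ᶜ γ) = ∅ →
      ∀ ρ ∈ closure (altDerivative (inducedWinningSet W (v r)) (inducedWinningSet W g)ᶜ γ ∩
          (inducedWinningSet W g)ᶜ),
        ∃ i < n, (ρ i).1 ≠ S r (outHistory (v r) (S r) (fun j => (ρ j).2) i)) :
    IsWinningFrom W [] (blockStrategy v S rep hn) := by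
  intro β
  by_contra hlose
  set s := blockStrategy v S rep hn with hs
  let g (i : ℕ) := outHistory [] s β (i * n)
  let ρ (i : ℕ) : Play A B := fun l => (s (outHistory [] s β (i * n + l)), β (i * n + l))
  have hρ (i : ℕ) : prepend (g i) (ρ i) = out [] s β := prepend_outHistory [] s β (i * n)
  have hadd (i l : ℕ) : outHistory [] s β (i * n + l) =
      outHistory (g i) s (fun j => β (i * n + j)) l := outHistory_add [] s β (i * n) l
  have hmul (i : ℕ) : g (i + 1) = outHistory (g i) s (fun j => β (i * n + j)) n := by
    rw [← hadd, ← Nat.succ_mul]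
  -- Invariant at block boundaries: the stored word is empty and the pretended winning set is
  -- contained in the true one.
  have hblock (i : ℕ) : ∃ r, (g i).foldl (blockUpdate v rep n) (rep [], ⟨[], hn⟩) =
      (r, ⟨[], hn⟩) ∧ g i ∈ Gamma W ∧ inducedWinningSet W (v r) ⊆ inducedWinningSet W (g i) := by
    induction i with
    | zero =>
      have hg₀ : g 0 = [] := by simp [g, outHistory]
      rw [hg₀]
      exact ⟨rep [], rfl, nil_mem_Gamma, hrep [] nil_mem_Gamma⟩
    | succ i ih =>
      obtain ⟨r, hr, hgi, hsub⟩ := ih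
      obtain ⟨k, -, h₁, h₂, h₃⟩ :=
        outHistory_blockStrategy_block v S rep hn hr fun j => β (i * n + j)
      obtain ⟨k', hk', h₄, h₅, -⟩ :=
        mem_Gamma_of_outHistory (hv r) hgi hsub (hS r) (fun j => β (i * n + j)) n
      obtain rfl := List.append_cancel_left (h₂.symm.trans hk')
      rw [hmul, h₁]
      exact ⟨_, h₃, h₅, (hrep _ h₄).trans (inducedWinningSet_append_mono hsub k)⟩
  choose r hr hgΓ hsub using hblock
  obtain ⟨⟨F, hF, hWF⟩, U, hU, hWU⟩ := hW
  have hGδ : IsGδ W := hWU ▸ IsGδ.iInter_of_isOpen hU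
  have hGδ' : IsGδ Wᶜ := by
    rw [hWF, compl_iUnion]
    exact IsGδ.iInter_of_isOpen fun i => (hF i).isOpen_compl
  obtain ⟨i, γ, hmem, hempty⟩ := exists_eventually_const_rank
    (X := fun i => inducedWinningSet W (v (r i))) (Z := fun i => (inducedWinningSet W (g i))ᶜ)
    (ρ := ρ) (fun i => hGδ.preimage (continuous_prepend (v (r i))))
    (fun i => hGδ'.preimage (continuous_prepend (g i)))
    (fun i => disjoint_compl_right_iff_subset.2 (hsub i)) fun i => by
      obtain ⟨k, hk, h₁, h₂, h₃⟩ :=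
        outHistory_blockStrategy_block v S rep hn (hr i) fun j => β (i * n + j)
      obtain ⟨k', hk', h₄, -, -⟩ :=
        mem_Gamma_of_outHistory (hv (r i)) (hgΓ i) (hsub i) (hS (r i)) (fun j => β (i * n + j)) n
      obtain rfl := List.append_cancel_left (h₂.symm.trans hk')
      have hg : g (i + 1) = g i ++ k := (hmul i).trans h₁
      have hri : r (i + 1) = rep (v (r i) ++ k) := by
        have := hr (i + 1)
        rw [hg, h₃] at this
        exact (congrArg Prod.fst this).symm
      refine ⟨k, hk, prepend_injective (g i) ?_, ?_, ?_⟩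
      · rw [← prepend_append, ← hg, hρ, hρ]
      -- The new representative has a winning set inside that of `v (r i) ++ k`; for the complements
      -- of the true winning sets, the next one is exactly the preimage.
      · intro x hx
        rw [hri] at hx
        have := hrep _ h₄ hx
        rwa [inducedWinningSet_append] at this
      · intro x hx
        rwa [hg, inducedWinningSet_append] at hx
  have hρi : ρ i ∈ (inducedWinningSet W (g i))ᶜ := fun h => hlose (by
    rw [← hρ i]
    exact h)
  -- The losing tail `ρ i` would have to leave `S (r i)` before round `n`, but block `i` follows it
  -- that long.
  obtain ⟨l, hl, hne⟩ :=
    hbound (r i) (g i) (hgΓ i) γ hempty (ρ i) (subset_closure ⟨hmem, hρi⟩)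
  obtain ⟨k, hk, -, h₁, h₂, h₃⟩ :=
    outHistory_blockStrategy v S rep hn (hr i) (fun j => β (i * n + j)) l hl
  refine hne ?_
  change s (outHistory [] s β (i * n + l)) = S (r i) (outHistory _ _ (fun j => β (i * n + j)) l)
  rw [h₂, hadd, hs, h₁, blockStrategy, h₃]

end BlockStrategy

end ConcurrentGame

/-- `A` and `B` are finite and carry the discrete topology, so that the topology of
`Play A B = (ℕ → A × B)` is the product topology, whose basis is given by the cylinders. -/
theorem mainTheorem1 {A B : Type*} [Finite A] [Finite B]
    [TopologicalSpace A] [DiscreteTopology A] [TopologicalSpace B] [DiscreteTopology B]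
    (W : Set (Play A B)) (hW : IsDelta02 W)
    (hwpo : Set.PartiallyWellOrderedOn (inducedWinningSet W '' Gamma W) (· ⊆ ·))
    (hwin : ∃ s : Strategy A B, IsWinningFrom W [] s) :
    ∃ s : Strategy A B, IsFiniteMemory s ∧ IsWinningFrom W [] s := by
  have hpwo : (inducedWinningSet W '' Gamma W).IsPWO := hwpo
  obtain ⟨R, hRΓ, hR, hbasis⟩ := exists_finite_basis hpwo
  have : Finite R := hR
  choose v hvΓ hvR using fun r : R => hRΓ r.2
  have hrep (h : History A B) : ∃ r : R, h ∈ Gamma W →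
      inducedWinningSet W (v r) ⊆ inducedWinningSet W h := by
    by_cases hh : h ∈ Gamma W
    · obtain ⟨r, hr, hrh⟩ := hbasis _ (Set.mem_image_of_mem _ hh)
      exact ⟨⟨r, hr⟩, fun _ => by rwa [hvR]⟩
    -- Outside `Γ` the representative is arbitrary; the empty history merely shows that one exists.
    · obtain ⟨r, hr, -⟩ := hbasis _ (Set.mem_image_of_mem _ (nil_mem_Gamma (W := W)))
      exact ⟨⟨r, hr⟩, fun hh' => absurd hh' hh⟩
  choose rep hrep using hrep
  choose S hS using fun r : R => isWinningHistory_of_mem_Gamma hwin (hvΓ r)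
  choose N hN using fun r : R => exists_forall_lt_ne hpwo (hS r)
  obtain ⟨n, hn⟩ := (Set.finite_range N).bddAbove
  -- The block length is `n + 1`, since it must be positive.
  refine ⟨blockStrategy v S rep n.succ_pos, isFiniteMemory_blockStrategy v S rep n.succ_pos,
    isWinningFrom_blockStrategy v S rep n.succ_pos hW hvΓ hrep hS
      fun r g hg γ hγ ρ hρ => ?_⟩
  obtain ⟨i, hi, hne⟩ := hN r g hg γ hγ ρ hρ
  exact ⟨i, hi.trans_le ((hn (Set.mem_range_self r)).trans n.le_succ), hne⟩
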